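/- Let $k$ be an algebraically closed field and let $C$ be a finite dimensional $k$-algebra of global dimension at most $2$. Modules are finitely generated right modules, and $D=\operatorname{Hom}_k(-,k)$ is the standard duality. Let $E=\operatorname{Ext}^2_C(DC,C)$, a $C$-$C$-bimodule whose left action is induced by left multiplication on the second argument $C$ and whose right action is induced by the left action of $C$ on $DC$. Let $B=C\ltimes E$ be the relation extension of $C$, that is, the algebra with underlying space $C\oplus E$ and multiplication $(c,e)(c',e')=(cc',\,ce'+ec')$. Every right $C$-module $M$ is regarded as a right $B$-module via $m\cdot(c,e)=mc$. For a finite dimensional $k$-algebra $\Lambda$ and a finitely generated right $\Lambda$-module $M$ with minimal projective presentation $P_1\xrightarrow{d_1}P_0\to M\to 0$, let $\tau_\Lambda M=D\operatorname{coker}\bigl(\operatorname{Hom}_\Lambda(P_0,\Lambda)\xrightarrow{\operatorname{Hom}_\Lambda(d_1,\Lambda)}\operatorname{Hom}_\Lambda(P_1,\Lambda)\bigr)$ be its Auslander-Reiten translate; $M$ is called $\tau_\Lambda$-rigid if $\operatorname{Hom}_\Lambda(M,\tau_\Lambda M)=0$. **Proposition.** Let $M$ be a $\tau_C$-rigid $C$-module.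 If $\operatorname{id}_C M\le 1$, then $M$ is $\tau_B$-rigid. -/

import Mathlib

/-!
Right modules over a ring `Λ` are modules over the opposite ring `Λᵐᵒᵖ`; thus the category of
right `Λ`-modules is `ModuleCat Λᵐᵒᵖ`, and `mod Λ` consists of its finitely generated objects.
-/

universe u

open CategoryTheory MulOpposite

noncomputable section

namespace RelExt

/-! ### The standard duality -/

section Duality

variable (k : Type u) [Field k] (Λ : Type u) [Ring Λ] [Algebra k Λ]
  (X : Type u) [AddCommGroup X] [Module k X] [Module Λ X] [IsScalarTower k Λ X]

/-- The standard dual `D X = Hom_k(X, k)` of a left `Λ`-module `X`. It is a right `Λ`-module,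
with `(f · a) x = f (a x)`. -/
def StdDual (_Λ : Type u) (X : Type u) [AddCommGroup X] [Module k X] : Type u :=
  Module.Dual k X

instance : AddCommGroup (StdDual k Λ X) :=
  inferInstanceAs (AddCommGroup (Module.Dual k X))

instance : Module Λᵐᵒᵖ (StdDual k Λ X) where
  smul a f := LinearMap.comp (show Module.Dual k X from f) (Algebra.lsmul k k X a.unop)
  one_smul f := LinearMap.ext fun x => congrArg (show Module.Dual k X from f) (one_smul Λ x)
  mul_smul a b f := LinearMap.ext fun x =>
    congrArg (show Module.Dual k X from f) (mul_smul b.unop a.unop x)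
  smul_zero _ := rfl
  smul_add _ _ _ := rfl
  add_smul a b f := LinearMap.ext fun x => by
    change (show Module.Dual k X from f) ((a.unop + b.unop) • x) =
      (show Module.Dual k X from f) (a.unop • x) + (show Module.Dual k X from f) (b.unop • x)
    rw [add_smul, map_add]
  zero_smul f := LinearMap.ext fun x => by
    change (show Module.Dual k X from f) ((0 : Λ) • x) = 0
    rw [zero_smul, map_zero]

end Duality

/-! ### Auslander-Reiten translation and `τ`-rigid modules -/

section Tau

/-- `f : P → M` is a projective cover in the category of finitely generated `R`-modules:
`P` is a finitely generated projective module, and `f` is surjective with superfluous kernel. -/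
structure IsProjectiveCover {R : Type u} [Ring R] {P M : Type u} [AddCommGroup P] [Module R P]
    [AddCommGroup M] [Module R M] (f : P →ₗ[R] M) : Prop where
  finite : Module.Finite R P
  projective : Module.Projective R P
  surjective : Function.Surjective f
  superfluous : ∀ N : Submodule R P, N ⊔ LinearMap.ker f = ⊤ → N = ⊤

/-- `P₁ --d₁--> P₀ --d₀--> M → 0` is a minimal projective presentation: it is exact, `d₀` is a
projective cover of `M`, and `d₁` is a projective cover of `im d₁ = ker d₀`. -/
structure IsMinimalProjectivePresentation {R : Type u} [Ring R] {P₁ P₀ M : Type u}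
    [AddCommGroup P₁] [Module R P₁] [AddCommGroup P₀] [Module R P₀] [AddCommGroup M] [Module R M]
    (d₁ : P₁ →ₗ[R] P₀) (d₀ : P₀ →ₗ[R] M) : Prop where
  cover₀ : IsProjectiveCover d₀
  exact : LinearMap.range d₁ = LinearMap.ker d₀
  cover₁ : IsProjectiveCover d₁.rangeRestrict

/-- Projective covers exist over an Artinian ring. -/
theorem exists_isProjectiveCover {R : Type u} [Ring R] [IsArtinianRing R] (M : Type u) [AddCommGroup M]
    [Module R M] [Module.Finite R M] :
    ∃ (P : ModuleCat.{u} R) (f : P →ₗ[R] M), IsProjectiveCover f := by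
  obtain ⟨n, f, hf⟩ := Module.Finite.exists_fin' R M
  let S : Set (Submodule R (Fin n → R)) :=
    {Q | Module.Projective R Q ∧ Q ⊔ LinearMap.ker f = ⊤}
  have hS : S.Nonempty := by
    refine ⟨⊤, ?_, by simp⟩
    exact Module.Projective.of_equiv (Submodule.topEquiv (R := R) (M := Fin n → R)).symm
  obtain ⟨Q, ⟨hQp, hQs⟩, hmin⟩ := IsArtinian.set_has_minimal S hS
  have hsurj : ∀ N : Submodule R Q, N ⊔ LinearMap.ker (f ∘ₗ Q.subtype) = ⊤ →
      Function.Surjective ((f ∘ₗ Q.subtype) ∘ₗ N.subtype) := by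
    intro N hN m
    obtain ⟨x, rfl⟩ := hf m
    have hx : x ∈ Q ⊔ LinearMap.ker f := hQs ▸ trivial
    obtain ⟨q, hq, z, hz, rfl⟩ := Submodule.mem_sup.1 hx
    have hq' : (⟨q, hq⟩ : Q) ∈ N ⊔ LinearMap.ker (f ∘ₗ Q.subtype) := hN ▸ trivial
    obtain ⟨a, ha, b, hb, hab⟩ := Submodule.mem_sup.1 hq'
    refine ⟨⟨a, ha⟩, ?_⟩
    have h1 : f b = 0 := hb
    have h2 : f z = 0 := hz
    have h3 : (a : Fin n → R) + b = q := congrArg Subtype.val hab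
    change f a = f (q + z)
    rw [← h3]; simp [h1, h2]
  refine ⟨ModuleCat.of R Q, f ∘ₗ Q.subtype, inferInstanceAs (Module.Finite R Q), hQp, ?_, ?_⟩
  · intro m
    obtain ⟨x, hx⟩ := hsurj ⊤ (by simp) m
    exact ⟨x, hx⟩
  · intro N hN
    change Submodule R Q at N
    obtain ⟨g, hg⟩ := Module.projective_lifting_property _ (f ∘ₗ Q.subtype) (hsurj N hN)
    let h : Module.End R Q := N.subtype ∘ₗ g
    have hfh : ∀ x, f (h x) = f x := fun x => LinearMap.congr_fun hg x
    obtain ⟨m, hm⟩ := ((Filter.eventually_ge_atTop 1).and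
      (LinearMap.eventually_isCompl_ker_pow_range_pow h)).exists
    obtain ⟨hm1, hm⟩ := hm
    have hfhm : ∀ j x, f ((h ^ j) x) = f x := by
      intro j
      induction j with
      | zero => intro x; rfl
      | succ j ih => intro x; rw [pow_succ', Module.End.mul_apply, hfh, ih]
    have hmem : (LinearMap.range (h ^ m)).map Q.subtype ∈ S := by
      constructor
      · have : Module.Projective R (LinearMap.range (h ^ m)) :=
          Module.Projective.of_split (LinearMap.range (h ^ m)).subtype
            (Submodule.projectionOnto _ _ hm.symm)
            (LinearMap.ext fun x => Submodule.projectionOnto_apply_left hm.symm x)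
        exact Module.Projective.of_equiv
          (Submodule.equivMapOfInjective Q.subtype Q.injective_subtype _)
      · rw [eq_top_iff]
        intro x _
        obtain ⟨y, hy⟩ := hsurj ⊤ (by simp) (f x)
        have hy' : f (y : Q) = f x := hy
        refine Submodule.mem_sup.2 ⟨((h ^ m) y : Q), ⟨(h ^ m) y, ⟨_, rfl⟩, rfl⟩,
          x - ((h ^ m) y : Q), ?_, by simp⟩
        rw [LinearMap.mem_ker, map_sub, hfhm, hy', sub_self]
    have hle : (LinearMap.range (h ^ m)).map Q.subtype ≤ Q := Submodule.map_subtype_le _ _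
    have heq : (LinearMap.range (h ^ m)).map Q.subtype = Q := by
      by_contra hne
      exact hmin _ hmem (lt_of_le_of_ne hle hne)
    rw [eq_top_iff]
    intro x _
    have hx : (x : Fin n → R) ∈ (LinearMap.range (h ^ m)).map Q.subtype :=
      (Submodule.ext_iff.1 heq _).2 x.2
    obtain ⟨_, ⟨z, rfl⟩, hz⟩ := hx
    have hz' : (h ^ m) z = x := Subtype.ext hz
    obtain ⟨j, rfl⟩ := Nat.exists_eq_add_of_le' hm1
    rw [← hz', pow_succ', Module.End.mul_apply]
    exact (g _).2

/-- Minimal projective presentations exist over an Artinian ring, in particular over a finite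
dimensional algebra. -/
theorem exists_isMinimalProjectivePresentation {R : Type u} [Ring R] [IsArtinianRing R] (M : Type u) [AddCommGroup M]
    [Module R M] [Module.Finite R M] :
    ∃ (P₁ P₀ : ModuleCat.{u} R) (d₁ : P₁ →ₗ[R] P₀) (d₀ : P₀ →ₗ[R] M),
      IsMinimalProjectivePresentation d₁ d₀ := by
  obtain ⟨P₀, d₀, h₀⟩ := exists_isProjectiveCover (R := R) M
  have := h₀.finite
  obtain ⟨P₁, p, h₁⟩ := exists_isProjectiveCover (R := R) (LinearMap.ker d₀)
  have hr : LinearMap.range ((LinearMap.ker d₀).subtype ∘ₗ p) = LinearMap.ker d₀ := by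
    rw [LinearMap.range_comp, LinearMap.range_eq_top.2 h₁.surjective, Submodule.map_top,
      Submodule.range_subtype]
  refine ⟨P₁, P₀, (LinearMap.ker d₀).subtype ∘ₗ p, d₀, h₀, hr, h₁.finite, h₁.projective,
    LinearMap.surjective_rangeRestrict _, ?_⟩
  intro N hN
  apply h₁.superfluous N
  rwa [LinearMap.ker_rangeRestrict, LinearMap.ker_comp, Submodule.ker_subtype,
    ← LinearMap.ker] at hN

variable (k : Type u) [Field k] {Λ : Type u} [Ring Λ] [Algebra k Λ]
  {P₁ P₀ : Type u} [AddCommGroup P₁] [Module Λᵐᵒᵖ P₁] [AddCommGroup P₀] [Module Λᵐᵒᵖ P₀]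

/-- The map `Hom_Λ(d, Λ) : Hom_Λ(P₀, Λ) → Hom_Λ(P₁, Λ)` of left `Λ`-modules induced by a map
`d : P₁ → P₀` of right `Λ`-modules. -/
def dualMap (d : P₁ →ₗ[Λᵐᵒᵖ] P₀) : (P₀ →ₗ[Λᵐᵒᵖ] Λ) →ₗ[Λ] (P₁ →ₗ[Λᵐᵒᵖ] Λ) where
  toFun φ := φ.comp d
  map_add' _ _ := rfl
  map_smul' _ _ := rfl

/-- The cokernel of `Hom_Λ(d, Λ)`, a left `Λ`-module. It is the transpose `Tr M` if
`d` is the first map of a minimal projective presentation of `M`. -/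
abbrev Transpose (d : P₁ →ₗ[Λᵐᵒᵖ] P₀) : Type u :=
  (P₁ →ₗ[Λᵐᵒᵖ] Λ) ⧸ LinearMap.range (dualMap d)

/-- The right `Λ`-module `D (coker Hom_Λ(d, Λ))`. It is the Auslander-Reiten translate
`τ M = D Tr M` if `d` is the first map of a minimal projective presentation of `M`. -/
abbrev Tau (d : P₁ →ₗ[Λᵐᵒᵖ] P₀) : Type u :=
  StdDual k Λ (Transpose d)

/-- The right `Λ`-module `M` is `τ`-rigid: `Hom_Λ(M, τ M) = 0`, where `τ M` is computed from a
minimal projective presentation of `M`. Such a presentation exists for a finitely generated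
module over a finite dimensional algebra and is unique up to isomorphism, so that any one of
them may be used. -/
def IsTauRigid (Λ : Type u) [Ring Λ] [Algebra k Λ] (M : Type u) [AddCommGroup M]
    [Module Λᵐᵒᵖ M] : Prop :=
  ∀ (P₁ P₀ : Type u) [AddCommGroup P₁] [Module Λᵐᵒᵖ P₁] [AddCommGroup P₀] [Module Λᵐᵒᵖ P₀]
    (d₁ : P₁ →ₗ[Λᵐᵒᵖ] P₀) (d₀ : P₀ →ₗ[Λᵐᵒᵖ] M), IsMinimalProjectivePresentation d₁ d₀ →
      ∀ f : M →ₗ[Λᵐᵒᵖ] Tau k d₁, f = 0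

end Tau

/-! ### The bimodule `Ext²(DC, C)` and the relation extension -/

/-- The global dimension of `C` is at most `n`: every finitely generated right `C`-module has
projective dimension at most `n`. -/
def GlobalDimensionLE (C : Type u) [Ring C] (n : ℕ) : Prop :=
  ∀ X : ModuleCat.{u} Cᵐᵒᵖ, Module.Finite Cᵐᵒᵖ X → HasProjectiveDimensionLE X n

section Bimodule

variable (k : Type u) [Field k] (C : Type u) [Ring C] [Algebra k C]

/-- `C` as a right `C`-module. -/
abbrev regularModule : ModuleCat.{u} Cᵐᵒᵖ := ModuleCat.of Cᵐᵒᵖ C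

/-- `DC = Hom_k(C, k)` as a right `C`-module. -/
abbrev dualModule : ModuleCat.{u} Cᵐᵒᵖ := ModuleCat.of Cᵐᵒᵖ (StdDual k C C)

/-- Left multiplication by `c`, an endomorphism of the right `C`-module `C`. -/
def leftMulRegular (c : C) : regularModule C ⟶ regularModule C :=
  ModuleCat.ofHom
    { toFun := fun x : C => c * x
      map_add' := mul_add c
      map_smul' := fun a x => (mul_assoc c x a.unop).symm }

/-- The left action `(c f)(x) = f(x c)` of `c` on `DC`, an endomorphism of the right
`C`-module `DC`. -/
def leftMulDual (c : C) : dualModule k C ⟶ dualModule k C :=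
  ModuleCat.ofHom (X := StdDual k C C) (Y := StdDual k C C)
    { toFun := fun f => LinearMap.comp (show Module.Dual k C from f) (LinearMap.mulRight k c)
      map_add' := fun _ _ => rfl
      map_smul' := fun a f => LinearMap.ext fun x =>
        congrArg (show Module.Dual k C from f) (mul_assoc a.unop x c).symm }

lemma leftMulRegular_one : leftMulRegular C 1 = 𝟙 _ := by
  refine ModuleCat.hom_ext (LinearMap.ext fun x => ?_)
  exact one_mul (x : C)

lemma leftMulRegular_mul (a b : C) :
    leftMulRegular C (a * b) = leftMulRegular C b ≫ leftMulRegular C a := by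
  refine ModuleCat.hom_ext (LinearMap.ext fun x => ?_)
  exact mul_assoc a b (x : C)

lemma leftMulRegular_add (a b : C) :
    leftMulRegular C (a + b) = leftMulRegular C a + leftMulRegular C b := by
  refine ModuleCat.hom_ext (LinearMap.ext fun x => ?_)
  exact add_mul a b (x : C)

lemma leftMulRegular_zero : leftMulRegular C 0 = 0 := by
  refine ModuleCat.hom_ext (LinearMap.ext fun x => ?_)
  exact zero_mul (x : C)

lemma leftMulDual_one : leftMulDual k C 1 = 𝟙 _ := by
  ext f
  exact LinearMap.ext fun x => congrArg (show Module.Dual k C from f) (mul_one x)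

lemma leftMulDual_mul (a b : C) :
    leftMulDual k C (a * b) = leftMulDual k C b ≫ leftMulDual k C a := by
  ext f
  exact LinearMap.ext fun x =>
    congrArg (show Module.Dual k C from f) (mul_assoc x a b).symm

lemma leftMulDual_add (a b : C) :
    leftMulDual k C (a + b) = leftMulDual k C a + leftMulDual k C b := by
  ext f
  exact LinearMap.ext fun x =>
    (congrArg (show Module.Dual k C from f) (mul_add x a b)).trans (map_add _ _ _)

lemma leftMulDual_zero : leftMulDual k C 0 = 0 := by
  ext f
  exact LinearMap.ext fun x =>
    (congrArg (show Module.Dual k C from f) (mul_zero x)).trans (map_zero _)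

lemma leftMulDual_smul (r : k) (c : C) :
    leftMulDual k C (r • c) = r • leftMulDual k C c := by
  ext f
  refine LinearMap.ext fun x => congrArg (show Module.Dual k C from f) ?_
  change x * (r • c) = algebraMap k C r * x * c
  rw [mul_smul_comm, Algebra.smul_def, mul_assoc]

/-- Postcomposition of a class in `Ext²_C(DC, C)` with the left multiplication of `c` on `C`. -/
def leftAct (c : C) (e : Abelian.Ext.{u} (dualModule k C) (regularModule C) 2) :
    Abelian.Ext.{u} (dualModule k C) (regularModule C) 2 :=
  e.comp (Abelian.Ext.mk₀ (leftMulRegular C c)) (add_zero 2)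

/-- Precomposition of a class in `Ext²_C(DC, C)` with the left action of `c` on `DC`. -/
def rightAct (c : C) (e : Abelian.Ext.{u} (dualModule k C) (regularModule C) 2) :
    Abelian.Ext.{u} (dualModule k C) (regularModule C) 2 :=
  (Abelian.Ext.mk₀ (leftMulDual k C c)).comp e (zero_add 2)

section

variable {k C} (a b : C) (r : k) (e e' : Abelian.Ext.{u} (dualModule k C) (regularModule C) 2)

lemma leftAct_one : leftAct k C 1 e = e := by
  simp [leftAct, leftMulRegular_one]

lemma leftAct_mul : leftAct k C (a * b) e = leftAct k C a (leftAct k C b e) := by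
  simp [leftAct, leftMulRegular_mul]

lemma leftAct_add : leftAct k C a (e + e') = leftAct k C a e + leftAct k C a e' := by
  simp [leftAct]

lemma leftAct_zero : leftAct k C a 0 = 0 := by
  simp [leftAct]

lemma add_leftAct : leftAct k C (a + b) e = leftAct k C a e + leftAct k C b e := by
  simp [leftAct, leftMulRegular_add, Abelian.Ext.mk₀_add]

lemma zero_leftAct : leftAct k C 0 e = 0 := by
  simp [leftAct, leftMulRegular_zero]

lemma leftAct_smul : leftAct k C (r • a) e = r • leftAct k C a e := by
  have h := Abelian.Ext.mk₀_smul r (leftMulRegular C a)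
  rw [leftAct, leftAct, ← Abelian.Ext.comp_smul, ← h]
  congr 2
  refine ModuleCat.hom_ext (LinearMap.ext fun x => ?_)
  change (r • a) * (x : C) = a * x * algebraMap k C r
  rw [← Algebra.commutes, smul_mul_assoc, Algebra.smul_def]

lemma rightAct_one : rightAct k C 1 e = e := by
  simp [rightAct, leftMulDual_one]

lemma rightAct_mul : rightAct k C (b * a) e = rightAct k C a (rightAct k C b e) := by
  simp [rightAct, leftMulDual_mul]

lemma rightAct_add : rightAct k C a (e + e') = rightAct k C a e + rightAct k C a e' := by
  simp [rightAct]

lemma rightAct_zero : rightAct k C a 0 = 0 := by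
  simp [rightAct]

lemma add_rightAct : rightAct k C (a + b) e = rightAct k C a e + rightAct k C b e := by
  simp [rightAct, leftMulDual_add, Abelian.Ext.mk₀_add]

lemma zero_rightAct : rightAct k C 0 e = 0 := by
  simp [rightAct, leftMulDual_zero]

lemma rightAct_smul : rightAct k C (r • a) e = r • rightAct k C a e := by
  simp [rightAct, leftMulDual_smul, Abelian.Ext.mk₀_smul]

lemma leftAct_rightAct :
    leftAct k C a (rightAct k C b e) = rightAct k C b (leftAct k C a e) := by
  simp [leftAct, rightAct]

end

/-- The `C`-`C`-bimodule `E = Ext²_C(DC, C)`, where `Ext` is taken over right `C`-modules. -/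
def ExtBimodule : Type u := Abelian.Ext.{u} (dualModule k C) (regularModule C) 2

instance : AddCommGroup (ExtBimodule k C) :=
  inferInstanceAs (AddCommGroup (Abelian.Ext.{u} (dualModule k C) (regularModule C) 2))

instance : Module k (ExtBimodule k C) :=
  inferInstanceAs (Module k (Abelian.Ext.{u} (dualModule k C) (regularModule C) 2))

/-- The left action of `C` on `E = Ext²_C(DC, C)`, induced by the left multiplication of `C`
on the second argument `C`. -/
instance : Module C (ExtBimodule k C) where
  smul c e := leftAct k C c e
  one_smul e := leftAct_one e
  mul_smul a b e := leftAct_mul a b e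
  smul_zero a := leftAct_zero a
  smul_add a e e' := leftAct_add a e e'
  add_smul a b e := add_leftAct a b e
  zero_smul e := zero_leftAct e

/-- The right action of `C` on `E = Ext²_C(DC, C)`, induced by the left action of `C` on the
first argument `DC`. -/
instance : Module Cᵐᵒᵖ (ExtBimodule k C) where
  smul c e := rightAct k C c.unop e
  one_smul e := rightAct_one e
  mul_smul a b e := rightAct_mul a.unop b.unop e
  smul_zero a := rightAct_zero a.unop
  smul_add a e e' := rightAct_add a.unop e e'
  add_smul a b e := add_rightAct a.unop b.unop e
  zero_smul e := zero_rightAct e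

instance : SMulCommClass C Cᵐᵒᵖ (ExtBimodule k C) where
  smul_comm a b e := leftAct_rightAct a b.unop e

instance : IsScalarTower k C (ExtBimodule k C) where
  smul_assoc r c e := leftAct_smul c r e

instance : IsScalarTower k Cᵐᵒᵖ (ExtBimodule k C) where
  smul_assoc r c e := rightAct_smul c.unop r e

/-- The relation extension `B = C ⋉ E` with `E = Ext²_C(DC, C)`: the `k`-algebra `C ⊕ E` with
multiplication `(c, e) (c', e') = (c c', c e' + e c')`. -/
abbrev RelationExtension : Type u := TrivSqZeroExt C (ExtBimodule k C)

/-- A right `C`-module `M` as a right `B`-module, with `m · (c, e) = m c`. -/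
abbrev inflation (M : ModuleCat.{u} Cᵐᵒᵖ) : ModuleCat.{u} (RelationExtension k C)ᵐᵒᵖ :=
  (ModuleCat.restrictScalars
    (TrivSqZeroExt.fstHom k C (ExtBimodule k C)).toRingHom.op).obj M

end Bimodule

end RelExt

end

/-! For projective `P₁` and `P₀`, the space `Hom(M, D coker Hom(d, Λ))` is dual to the cokernel of
`Hom(d, M) : Hom(P₀, M) → Hom(P₁, M)`. So `M` is `τ`-rigid exactly when every map `P₁ → M` factors
through the first map of a minimal presentation (`eq_zero_of_forall_factors`,
`exists_factor_of_forall_eq_zero`).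

Since `pd DC ≤ 2`, the functor `Ext²(DC, -)` is right exact, whence `M ⊗ E ≅ Ext²(DC, M)`, and this
vanishes because `id M ≤ 1`. Only the vanishing is needed; `balanced_eq_zero` states it through
balanced maps, without tensor products.

Let `P₁ → P₀ → M` be a minimal presentation over `B`, and let `K` be the kernel of `P₀ → M`. From `M
⊗ E = 0` it follows that `P₀E = KE` (`ker_smul_top_le_ker_smul_ker`), which is what keeps the
presentation exact and minimal after reduction modulo `E`
(`IsMinimalProjectivePresentation.reduction`). A `B`-map `P₁ → M` kills `P₁E`, so it factors through
`P₁/P₁E`; by `τ_C`-rigidity it then extends over `P₀/P₀E`, hence over `P₀`. -/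

noncomputable section

namespace RelExt

/-! ### A criterion for `τ`-rigidity -/

section Criterion

variable {Λ : Type u} [Ring Λ]

/-- The map `Λ → M`, `x ↦ m x`, of right modules. -/
def orbitMap {M : Type u} [AddCommGroup M] [Module Λᵐᵒᵖ M] (m : M) : Λ →ₗ[Λᵐᵒᵖ] M where
  toFun x := op x • m
  map_add' x y := by rw [MulOpposite.op_add, add_smul]
  map_smul' a x := (mul_smul a (op x) m)

@[simp]
lemma orbitMap_apply {M : Type u} [AddCommGroup M] [Module Λᵐᵒᵖ M] (m : M) (x : Λ) :
    orbitMap m x = op x • m := rfl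

/-- A finitely generated projective right module has a finite dual basis. -/
lemma exists_dual_basis (P : Type u) [AddCommGroup P] [Module Λᵐᵒᵖ P] [Module.Finite Λᵐᵒᵖ P]
    [Module.Projective Λᵐᵒᵖ P] :
    ∃ (n : ℕ) (p : Fin n → P) (ψ : Fin n → P →ₗ[Λᵐᵒᵖ] Λ), ∀ x, ∑ i, op (ψ i x) • p i = x := by
  obtain ⟨n, f, hf⟩ := Module.Finite.exists_fin' Λᵐᵒᵖ P
  obtain ⟨g, hg⟩ := Module.projective_lifting_property f LinearMap.id hf
  -- The coordinates of the splitting `g` lie in `Λᵐᵒᵖ`; acting with them on `1 : Λ` turns them into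
  -- right linear functionals with values in `Λ`.
  refine ⟨n, fun i => f (Pi.single i 1),
    fun i => LinearMap.toSpanSingleton Λᵐᵒᵖ Λ 1 ∘ₗ LinearMap.proj i ∘ₗ g, fun x => ?_⟩
  have h : f (g x) = x := LinearMap.congr_fun hg x
  conv_rhs => rw [← h, LinearMap.pi_apply_eq_sum_univ f (g x)]
  refine Finset.sum_congr rfl fun i _ => ?_
  have h2 : op ((LinearMap.toSpanSingleton Λᵐᵒᵖ Λ 1 ∘ₗ LinearMap.proj i ∘ₗ g) x) = g x i := by
    simp
  rw [h2]
  refine congrArg (fun y => g x i • f y) (funext fun j => ?_)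
  simp [Pi.single_apply, eq_comm]

variable (k : Type u) [Field k] [Algebra k Λ] {P₁ P₀ : Type u} [AddCommGroup P₁]
  [Module Λᵐᵒᵖ P₁] [AddCommGroup P₀] [Module Λᵐᵒᵖ P₀] {M : Type u} [AddCommGroup M]
  [Module Λᵐᵒᵖ M]

/-- If every map `P₁ → M` factors through `d : P₁ → P₀`, then `Hom(M, D coker Hom(d, Λ)) = 0`. -/
lemma eq_zero_of_forall_factors [Module.Finite Λᵐᵒᵖ P₁] [Module.Projective Λᵐᵒᵖ P₁]
    [Module.Finite Λᵐᵒᵖ P₀] [Module.Projective Λᵐᵒᵖ P₀] (d : P₁ →ₗ[Λᵐᵒᵖ] P₀)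
    (hd : ∀ g : P₁ →ₗ[Λᵐᵒᵖ] M, ∃ h : P₀ →ₗ[Λᵐᵒᵖ] M, h ∘ₗ d = g)
    (f : M →ₗ[Λᵐᵒᵖ] Tau k d) : f = 0 := by
  -- By adjunction `f` is a balanced pairing of `M` with `Hom(P₁, Λ)` that vanishes on the
  -- functionals factoring through `d`.
  let F (m : M) (φ : P₁ →ₗ[Λᵐᵒᵖ] Λ) : k :=
    (show Module.Dual k (Transpose d) from f m) (Submodule.Quotient.mk φ)
  have F_add (m m' : M) (φ) : F (m + m') φ = F m φ + F m' φ := by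
    simp only [F, map_add]; rfl
  have F_zero (φ) : F 0 φ = 0 := by
    simp only [F, map_zero]; rfl
  have F_sum {ι : Type} (s : Finset ι) (m : ι → M) (φ) : F (∑ i ∈ s, m i) φ = ∑ i ∈ s, F (m i) φ :=
    map_sum (AddMonoidHom.mk' (fun m => F m φ) fun a b => F_add a b φ) m s
  have F_add' (m : M) (φ φ') : F m (φ + φ') = F m φ + F m φ' :=
    map_add (show Module.Dual k (Transpose d) from f m) (Submodule.Quotient.mk φ)
      (Submodule.Quotient.mk φ')
  have F_sum' {ι : Type} (s : Finset ι) (m : M) (φ : ι → P₁ →ₗ[Λᵐᵒᵖ] Λ) :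
      F m (∑ i ∈ s, φ i) = ∑ i ∈ s, F m (φ i) :=
    map_sum (AddMonoidHom.mk' (fun φ => F m φ) fun a b => F_add' m a b) φ s
  have F_smul (m : M) (a : Λ) (φ) : F (op a • m) φ = F m (a • φ) := by
    simp only [F, map_smul]; rfl
  have F_range (m : M) (ψ : P₀ →ₗ[Λᵐᵒᵖ] Λ) : F m (ψ ∘ₗ d) = 0 := by
    have h : (Submodule.Quotient.mk (ψ ∘ₗ d) : Transpose d) = 0 :=
      (Submodule.Quotient.mk_eq_zero _).2 ⟨ψ, rfl⟩
    simp only [F, h]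
    exact map_zero _
  obtain ⟨n₁, q, θ, hθ⟩ := exists_dual_basis (Λ := Λ) P₁
  obtain ⟨n₀, p, ψ, hψ⟩ := exists_dual_basis (Λ := Λ) P₀
  have key (m : M) (φ : P₁ →ₗ[Λᵐᵒᵖ] Λ) : F m φ = 0 := by
    -- The hypothesis is applied to the rank one map `x ↦ m φ(x)`. Under `M ⊗ Hom(P₁, Λ) ≅ Hom(P₁,
    -- M)`, the factorization `h ∘ d` rewrites `m ⊗ φ` as `∑ h(pᵢ) ⊗ (ψᵢ ∘ d)`; the calculation
    -- below carries this out with dual bases.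
    obtain ⟨h, hh⟩ := hd (orbitMap m ∘ₗ φ)
    have hq (j) : op (φ (q j)) • m = h (d (q j)) := (LinearMap.congr_fun hh (q j)).symm
    have hφ : φ = ∑ j, φ (q j) • θ j := by
      ext x
      conv_lhs => rw [← hθ x, map_sum]
      simp
    have hψd (i) : ψ i ∘ₗ d = ∑ j, (ψ i (d (q j))) • θ j := by
      ext x
      conv_lhs => rw [LinearMap.comp_apply, ← hθ x, map_sum, map_sum]
      simp
    have hexp (j) : h (d (q j)) = ∑ i, op (ψ i (d (q j))) • h (p i) := by
      conv_lhs => rw [← hψ (d (q j)), map_sum]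
      simp
    calc F m φ = ∑ j, F (h (d (q j))) (θ j) := by
          conv_lhs => rw [hφ, F_sum']
          simp only [← F_smul, hq]
      _ = ∑ j, ∑ i, F (h (p i)) (ψ i (d (q j)) • θ j) := by
          simp only [hexp, F_sum, F_smul]
      _ = ∑ i, F (h (p i)) (ψ i ∘ₗ d) := by
          rw [Finset.sum_comm]
          simp only [hψd, F_sum']
      _ = 0 := Finset.sum_eq_zero fun i _ => F_range _ _
  ext m
  change (show Module.Dual k (Transpose d) from f m) = 0
  refine LinearMap.ext fun t => ?_
  obtain ⟨φ, rfl⟩ := Submodule.Quotient.mk_surjective _ t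
  exact key m φ

/-- If `Hom(M, D coker Hom(d, Λ)) = 0` for `d : P₁ → P₀`, then every map `P₁ → M` factors
through `d`. -/
lemma exists_factor_of_forall_eq_zero [Module k M] [IsScalarTower k Λᵐᵒᵖ M]
    [Module.Finite Λᵐᵒᵖ P₁] [Module.Projective Λᵐᵒᵖ P₁] (d : P₁ →ₗ[Λᵐᵒᵖ] P₀)
    (hd : ∀ f : M →ₗ[Λᵐᵒᵖ] Tau k d, f = 0) (g : P₁ →ₗ[Λᵐᵒᵖ] M) :
    ∃ h : P₀ →ₗ[Λᵐᵒᵖ] M, h ∘ₗ d = g := by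
  have : SMulCommClass Λᵐᵒᵖ k M := (IsScalarTower.to_smulCommClass (R := k) (A := Λᵐᵒᵖ)).symm
  let pre : (P₀ →ₗ[Λᵐᵒᵖ] M) →ₗ[k] (P₁ →ₗ[Λᵐᵒᵖ] M) :=
    { toFun := fun h => h ∘ₗ d
      map_add' := fun _ _ => rfl
      map_smul' := fun _ _ => rfl }
  by_contra hg
  -- A `k`-linear functional on `Hom(P₁, M)` separates `g` from the maps that factor through `d`.
  -- Its adjoint `m ↦ (φ ↦ l (m φ))` is a map `M → Tau k d`.
  obtain ⟨l, hl0, hl⟩ := Submodule.exists_le_ker_of_notMem (p := LinearMap.range pre)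
    (v := g) (by simpa [pre] using hg)
  let outer (m : M) : (P₁ →ₗ[Λᵐᵒᵖ] Λ) →ₗ[k] (P₁ →ₗ[Λᵐᵒᵖ] M) :=
    { toFun := fun φ => orbitMap m ∘ₗ φ
      map_add' := fun φ φ' => by ext x; simp [add_smul]
      map_smul' := fun r φ => by ext x; simp }
  have hrange (m : M) : (LinearMap.range (dualMap d)).restrictScalars k ≤
      LinearMap.ker (l ∘ₗ outer m) := by
    rintro _ ⟨ψ, rfl⟩
    exact hl ⟨orbitMap m ∘ₗ ψ, rfl⟩
  let f : M →ₗ[Λᵐᵒᵖ] Tau k d :=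
    { toFun := fun m => show Module.Dual k (Transpose d) from
        Submodule.liftQ _ (l ∘ₗ outer m) (hrange m) ∘ₗ
          (Submodule.Quotient.restrictScalarsEquiv k (LinearMap.range (dualMap d))).symm
      map_add' := fun m m' => by
        refine LinearMap.ext fun t => ?_
        obtain ⟨φ, rfl⟩ := Submodule.Quotient.mk_surjective _ t
        change l (outer (m + m') φ) = l (outer m φ) + l (outer m' φ)
        rw [← map_add]
        congr 1
        ext x
        simp [outer]
      map_smul' := fun a m => by
        refine LinearMap.ext fun t => ?_
        obtain ⟨φ, rfl⟩ := Submodule.Quotient.mk_surjective _ t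
        change l (outer (a • m) φ) = l (outer m (a.unop • φ))
        congr 1
        ext x
        simp [outer, mul_smul] }
  have hf (m : M) (φ : P₁ →ₗ[Λᵐᵒᵖ] Λ) : l (orbitMap m ∘ₗ φ) = 0 :=
    LinearMap.congr_fun
      (show (show Module.Dual k (Transpose d) from f m) = 0 from LinearMap.congr_fun (hd f) m)
      (Submodule.Quotient.mk φ)
  obtain ⟨n, q, θ, hθ⟩ := exists_dual_basis (Λ := Λ) P₁
  -- By the dual basis `g` is a sum of rank one maps, and `l` vanishes on all of these because the
  -- adjoint map is zero.
  have hgs : g = ∑ j, orbitMap (g (q j)) ∘ₗ θ j := by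
    ext x
    conv_lhs => rw [← hθ x, map_sum]
    simp
  apply hl0
  rw [hgs, map_sum]
  exact Finset.sum_eq_zero fun j _ => hf _ _

end Criterion

/-! ### Vanishing of `M ⊗ Ext²(DC, C)` -/

section Balanced

variable {C : Type u} [Ring C]

/-- The map `Cⁿ → M`, `x ↦ ∑ mᵢ xᵢ`, of right modules. -/
def rowMap {M : Type u} [AddCommGroup M] [Module Cᵐᵒᵖ M] {n : ℕ} (m : Fin n → M) :
    (Fin n → C) →ₗ[Cᵐᵒᵖ] M :=
  ∑ i, orbitMap (m i) ∘ₗ LinearMap.proj i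

lemma rowMap_apply {M : Type u} [AddCommGroup M] [Module Cᵐᵒᵖ M] {n : ℕ} (m : Fin n → M)
    (x : Fin n → C) : rowMap m x = ∑ i, op (x i) • m i := by
  simp [rowMap]

lemma exists_rowMap_surjective (M : Type u) [AddCommGroup M] [Module Cᵐᵒᵖ M]
    [Module.Finite Cᵐᵒᵖ M] :
    ∃ (n : ℕ) (m : Fin n → M), Function.Surjective (rowMap (C := C) m) := by
  obtain ⟨n, s, hs⟩ := Module.Finite.exists_fin (R := Cᵐᵒᵖ) (M := M)
  refine ⟨n, s, fun x => ?_⟩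
  have hx : x ∈ Submodule.span Cᵐᵒᵖ (Set.range s) := hs ▸ trivial
  obtain ⟨c, rfl⟩ := (Submodule.mem_span_range_iff_exists_fun Cᵐᵒᵖ).1 hx
  exact ⟨fun i => (c i).unop, by simp [rowMap_apply]⟩

/-- Projection of the right module `Cⁿ` to a factor. -/
def coordProj (C : Type u) [Ring C] {n : ℕ} (i : Fin n) :
    ModuleCat.of Cᵐᵒᵖ (Fin n → C) ⟶ regularModule C :=
  ModuleCat.ofHom (LinearMap.proj i)

/-- Inclusion of a factor in the right module `Cⁿ`. -/
def coordIncl (C : Type u) [Ring C] {n : ℕ} (i : Fin n) :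
    regularModule C ⟶ ModuleCat.of Cᵐᵒᵖ (Fin n → C) :=
  ModuleCat.ofHom (LinearMap.single Cᵐᵒᵖ (fun _ => C) i)

lemma coordIncl_coordProj_same {n : ℕ} (i : Fin n) : coordIncl C i ≫ coordProj C i = 𝟙 _ := by
  refine ModuleCat.hom_ext (LinearMap.ext fun x => ?_)
  exact Pi.single_eq_same (M := fun _ => C) i x

lemma coordIncl_coordProj_ne {n : ℕ} {i j : Fin n} (h : j ≠ i) :
    coordIncl C i ≫ coordProj C j = 0 := by
  refine ModuleCat.hom_ext (LinearMap.ext fun x => ?_)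
  exact Pi.single_eq_of_ne (M := fun _ => C) h x

/-- A map of free right modules is left multiplication by its matrix. After applying `Ext²(DC, -)`,
the entries therefore act through the left action on `E`. -/
lemma comp_coordProj {t n : ℕ} (d : (Fin t → C) →ₗ[Cᵐᵒᵖ] (Fin n → C)) (i : Fin n) :
    ModuleCat.ofHom d ≫ coordProj C i =
      ∑ j, coordProj C j ≫ leftMulRegular C (d (Pi.single j 1) i) := by
  refine ModuleCat.hom_ext (LinearMap.ext fun x => ?_)
  rw [ModuleCat.hom_sum, LinearMap.sum_apply]
  change d x i = ∑ j, d (Pi.single j 1) i * x j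
  have hx : x = ∑ j, op (x j) • (Pi.single j 1 : Fin t → C) := by
    funext l
    simp [Finset.sum_apply, Pi.single_apply]
  conv_lhs => rw [hx, map_sum, Finset.sum_apply]
  simp

/-- The obstruction to lifting lies in `Ext` of degree `n + 1` from `A` to the kernel of `p`, which
is zero. This is the right exactness of the top `Ext`. -/
lemma ext_comp_surjective_of_epi {A X Y : ModuleCat.{u} Cᵐᵒᵖ} {n : ℕ}
    [HasProjectiveDimensionLE A n] (p : X ⟶ Y) [Epi p] (y : Abelian.Ext.{u} A Y n) :
    ∃ x : Abelian.Ext.{u} A X n, x.comp (Abelian.Ext.mk₀ p) (add_zero n) = y := by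
  let S := ShortComplex.mk (Limits.kernel.ι p) p (Limits.kernel.condition p)
  have hS : S.ShortExact := { exact := ShortComplex.exact_kernel p }
  refine Abelian.Ext.covariant_sequence_exact₃ A hS y rfl ?_
  exact Abelian.Ext.eq_zero_of_hasProjectiveDimensionLT _ (n + 1) le_rfl

variable (k : Type u) [Field k] [Algebra k C]

/-- If `Ext²(DC, M) = 0` and `DC` has projective dimension at most two, then `M ⊗ Ext²(DC, C) = 0`:
every balanced biadditive map on `M × Ext²(DC, C)` vanishes. -/
lemma balanced_eq_zero [IsNoetherianRing Cᵐᵒᵖ]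
    [HasProjectiveDimensionLE (dualModule k C) 2] (M : ModuleCat.{u} Cᵐᵒᵖ)
    [Module.Finite Cᵐᵒᵖ M] [HasInjectiveDimensionLE M 1] {A : Type u} [AddCommGroup A]
    (β : M →+ ExtBimodule k C →+ A)
    (hβ : ∀ (m : M) (c : C) (e : ExtBimodule k C), β (op c • m) e = β m (c • e)) : β = 0 := by
  obtain ⟨n, m, hm⟩ := exists_rowMap_surjective (C := C) M
  have : Module.Finite Cᵐᵒᵖ C :=
    Module.Finite.of_surjective (LinearMap.toSpanSingleton Cᵐᵒᵖ C 1) fun x => ⟨op x, by simp⟩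
  have : IsNoetherian Cᵐᵒᵖ C := isNoetherian_of_isNoetherianRing_of_finite _ _
  -- Noetherianity yields a finite presentation `Cᵗ → Cⁿ → M`, with matrix `a` below.
  obtain ⟨t, s, hs⟩ := exists_rowMap_surjective (C := C) (LinearMap.ker (rowMap (C := C) m))
  let N : ModuleCat.{u} Cᵐᵒᵖ := ModuleCat.of Cᵐᵒᵖ (LinearMap.ker (rowMap (C := C) m))
  let ι : N ⟶ ModuleCat.of Cᵐᵒᵖ (Fin n → C) :=
    ModuleCat.ofHom (LinearMap.ker (rowMap (C := C) m)).subtype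
  let p : ModuleCat.of Cᵐᵒᵖ (Fin n → C) ⟶ M := ModuleCat.ofHom (rowMap m)
  let q : ModuleCat.of Cᵐᵒᵖ (Fin t → C) ⟶ N := ModuleCat.ofHom (rowMap s)
  have : Epi q := (ModuleCat.epi_iff_surjective q).2 hs
  let S : ShortComplex (ModuleCat.{u} Cᵐᵒᵖ) :=
    ShortComplex.mk ι p (ModuleCat.hom_ext (LinearMap.ext fun x => x.2))
  have hS : S.ShortExact :=
    { exact := (ShortComplex.ShortExact.moduleCat_exact_iff_function_exact S).2
        fun x => ⟨fun hx => ⟨⟨x, hx⟩, rfl⟩, fun ⟨y, hy⟩ => hy ▸ y.2⟩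
      mono_f := (ModuleCat.mono_iff_injective ι).2 Subtype.val_injective
      epi_g := (ModuleCat.epi_iff_surjective p).2 hm }
  let d : (Fin t → C) →ₗ[Cᵐᵒᵖ] (Fin n → C) := (LinearMap.ker (rowMap (C := C) m)).subtype ∘ₗ rowMap s
  let a (i : Fin n) (j : Fin t) : C := d (Pi.single j 1) i
  have ha (j) : ∑ i, op (a i j) • m i = 0 := by
    rw [← rowMap_apply m (fun i => a i j)]
    exact (rowMap s (Pi.single j 1)).2
  have hgen (i : Fin n) (e : ExtBimodule k C) : β (m i) e = 0 := by
    let e' : Abelian.Ext.{u} (dualModule k C) (regularModule C) 2 := e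
    -- The class `e` is placed in coordinate `i` of `Ext²(DC, Cⁿ)`. Its image in `Ext²(DC, M) = 0`
    -- vanishes, so it comes from the kernel `N`, and then from `Cᵗ` by right exactness.
    let x := e'.comp (Abelian.Ext.mk₀ (coordIncl C i)) (add_zero 2)
    obtain ⟨y, hy⟩ := Abelian.Ext.covariant_sequence_exact₂ _ hS x
      (Abelian.Ext.eq_zero_of_hasInjectiveDimensionLT _ 2 le_rfl)
    obtain ⟨z, rfl⟩ := ext_comp_surjective_of_epi q y
    let z' (j : Fin t) : ExtBimodule k C :=
      z.comp (Abelian.Ext.mk₀ (coordProj C j)) (add_zero 2)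
    have hz : z.comp (Abelian.Ext.mk₀ (ModuleCat.ofHom d)) (add_zero 2) = x := by
      rw [← hy, Abelian.Ext.comp_assoc_of_third_deg_zero, Abelian.Ext.mk₀_comp_mk₀]
      rfl
    have hx (l : Fin n) : (x.comp (Abelian.Ext.mk₀ (coordProj C l)) (add_zero 2) :
        ExtBimodule k C) = ∑ j, a l j • z' j := by
      rw [← hz, Abelian.Ext.comp_assoc_of_third_deg_zero, Abelian.Ext.mk₀_comp_mk₀,
        comp_coordProj, Abelian.Ext.mk₀_sum, Abelian.Ext.comp_sum]
      refine Finset.sum_congr rfl fun j _ => ?_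
      rw [← Abelian.Ext.mk₀_comp_mk₀, ← Abelian.Ext.comp_assoc_of_third_deg_zero]
      rfl
    have hx_same : (x.comp (Abelian.Ext.mk₀ (coordProj C i)) (add_zero 2) :
        ExtBimodule k C) = e := by
      rw [Abelian.Ext.comp_assoc_of_third_deg_zero, Abelian.Ext.mk₀_comp_mk₀,
        coordIncl_coordProj_same, Abelian.Ext.comp_mk₀_id]
    have hx_ne (l : Fin n) (hl : l ≠ i) :
        (x.comp (Abelian.Ext.mk₀ (coordProj C l)) (add_zero 2) : ExtBimodule k C) = 0 := by
      rw [Abelian.Ext.comp_assoc_of_third_deg_zero, Abelian.Ext.mk₀_comp_mk₀,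
        coordIncl_coordProj_ne hl, Abelian.Ext.mk₀_zero, Abelian.Ext.comp_zero]
    -- Balancedness moves the matrix entries onto the generators `m l`, where they form the
    -- relations `ha`.
    calc β (m i) e = ∑ l, β (m l) (∑ j, a l j • z' j) := by
          rw [Finset.sum_eq_single i, ← hx, hx_same]
          · intro l _ hl
            rw [← hx, hx_ne l hl]
            exact map_zero (β (m l))
          · simp
      _ = ∑ j, β (∑ l, op (a l j) • m l) (z' j) := by
          simp only [map_sum, AddMonoidHom.finsetSum_apply, hβ]
          exact Finset.sum_comm
      _ = 0 := by simp [ha]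
  ext x e
  obtain ⟨c, rfl⟩ := hm x
  simp [rowMap_apply, hβ, hgen]

end Balanced

/-! ### Reduction of minimal presentations along a split surjection of rings -/

section Reduction

variable {R S : Type u} [Ring R] [Ring S] (π : R →+* S) (σ : S →+* R)

/-- The quotient `P / IP` for the kernel `I` of a surjection `π : R → S` with section `σ`,
regarded as an `S`-module. -/
def Reduction (_σ : S →+* R) (P : Type u) [AddCommGroup P] [Module R P] : Type u :=
  P ⧸ (RingHom.ker π • (⊤ : Submodule R P))

variable {P Q M : Type u} [AddCommGroup P] [Module R P] [AddCommGroup Q] [Module R Q]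
  [AddCommGroup M] [Module R M]

instance : AddCommGroup (Reduction π σ P) :=
  inferInstanceAs (AddCommGroup (P ⧸ (RingHom.ker π • (⊤ : Submodule R P))))

instance : Module R (Reduction π σ P) :=
  inferInstanceAs (Module R (P ⧸ (RingHom.ker π • (⊤ : Submodule R P))))

/-- Restriction along the section avoids descending the action to `R / I`. When `π ∘ σ = id`,
`Reduction.smul_mk` shows that both structures agree. -/
instance : Module S (Reduction π σ P) := Module.compHom _ σ

lemma smul_reduction (s : S) (x : Reduction π σ P) : s • x = σ s • x := rfl

variable (P) in
/-- The projection `P → P / IP`. -/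
def Reduction.mk : P →ₗ[R] Reduction π σ P :=
  (RingHom.ker π • (⊤ : Submodule R P)).mkQ

lemma Reduction.mk_surjective : Function.Surjective (Reduction.mk π σ P) :=
  Submodule.mkQ_surjective _

lemma Reduction.ker_mk :
    LinearMap.ker (Reduction.mk π σ P) = RingHom.ker π • (⊤ : Submodule R P) :=
  Submodule.ker_mkQ _

variable {π σ}

lemma ker_smul_top_le {f : P →ₗ[R] M} (hM : ∀ r ∈ RingHom.ker π, ∀ m : M, r • m = 0) :
    RingHom.ker π • (⊤ : Submodule R P) ≤ LinearMap.ker f :=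
  Submodule.smul_le.2 fun r hr x _ => by rw [LinearMap.mem_ker, map_smul, hM r hr]

lemma Reduction.ker_smul (r : R) (hr : r ∈ RingHom.ker π) (x : Reduction π σ P) : r • x = 0 := by
  obtain ⟨x, rfl⟩ := Reduction.mk_surjective π σ x
  rw [← map_smul, ← LinearMap.mem_ker, Reduction.ker_mk]
  exact Submodule.smul_mem_smul hr trivial

/-- An `R`-linear map from `P` to a module killed by `I` induces an `S`-linear map on `P / IP`. -/
def Reduction.lift [Module S M] (hS : ∀ (s : S) (m : M), s • m = σ s • m)
    (hM : ∀ r ∈ RingHom.ker π, ∀ m : M, r • m = 0) (f : P →ₗ[R] M) :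
    Reduction π σ P →ₗ[S] M where
  toFun := (RingHom.ker π • (⊤ : Submodule R P)).liftQ f (ker_smul_top_le hM)
  map_add' := map_add _
  map_smul' s x := by rw [RingHom.id_apply, hS]; exact map_smul _ (σ s) x

variable (π σ) in
/-- The map `P / IP → Q / IQ` induced by `P → Q`. -/
def Reduction.map (f : P →ₗ[R] Q) : Reduction π σ P →ₗ[S] Reduction π σ Q :=
  Reduction.lift (fun _ _ => rfl) Reduction.ker_smul (Reduction.mk π σ Q ∘ₗ f)

@[simp]
lemma Reduction.map_mk (f : P →ₗ[R] Q) (x : P) :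
    Reduction.map π σ f (Reduction.mk π σ P x) = Reduction.mk π σ Q (f x) := rfl

/-- The difference `σ (π r) - r` lies in the kernel of `π`, which kills the quotient. -/
lemma Reduction.smul_mk (hσ : ∀ s, π (σ s) = s) (r : R) (x : P) :
    π r • Reduction.mk π σ P x = Reduction.mk π σ P (r • x) := by
  rw [smul_reduction, map_smul, ← sub_eq_zero, ← sub_smul]
  exact Reduction.ker_smul _ (by simp [RingHom.mem_ker, hσ]) _

lemma Reduction.finite (hσ : ∀ s, π (σ s) = s) [Module.Finite R P] :
    Module.Finite S (Reduction π σ P) := by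
  obtain ⟨n, s, hs⟩ := Module.Finite.exists_fin (R := R) (M := P)
  rw [Module.finite_def, Submodule.fg_iff_exists_fin_generating_family]
  refine ⟨n, fun i => Reduction.mk π σ P (s i), eq_top_iff.2 fun x _ => ?_⟩
  obtain ⟨x, rfl⟩ := Reduction.mk_surjective π σ x
  have hx : x ∈ Submodule.span R (Set.range s) := hs ▸ trivial
  obtain ⟨c, rfl⟩ := (Submodule.mem_span_range_iff_exists_fun R).1 hx
  rw [map_sum]
  refine Submodule.sum_mem _ fun i _ => ?_
  rw [← Reduction.smul_mk hσ]
  exact Submodule.smul_mem _ _ (Submodule.subset_span ⟨i, rfl⟩)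

/-- Viewed over `R` through `π`, the free cover of `P / IP` receives a lift of `P → P / IP`. The
lift kills `IP` because its target is an `S`-module, so it descends to a splitting. -/
lemma Reduction.projective (hσ : ∀ s, π (σ s) = s) [Module.Projective R P] :
    Module.Projective S (Reduction π σ P) := by
  refine Module.Projective.of_lifting_property'' fun f hf => ?_
  let : Module R (Reduction π σ P →₀ S) := Module.compHom _ π
  let f' : (Reduction π σ P →₀ S) →ₗ[R] Reduction π σ P :=
    { toFun := f
      map_add' := map_add f
      map_smul' := fun r x => by
        obtain ⟨y, hy⟩ := Reduction.mk_surjective π σ (f x)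
        change f (π r • x) = r • f x
        rw [map_smul, ← hy, Reduction.smul_mk hσ, map_smul] }
  obtain ⟨g, hg⟩ := Module.projective_lifting_property f' (Reduction.mk π σ P) hf
  have hM (r : R) (hr : r ∈ RingHom.ker π) (m : Reduction π σ P →₀ S) : r • m = 0 := by
    change π r • m = 0
    rw [RingHom.mem_ker.1 hr, zero_smul]
  have hS (s : S) (m : Reduction π σ P →₀ S) : s • m = σ s • m := by
    change s • m = π (σ s) • m
    rw [hσ]
  refine ⟨Reduction.lift hS hM g, LinearMap.ext fun x => ?_⟩
  obtain ⟨x, rfl⟩ := Reduction.mk_surjective π σ x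
  exact LinearMap.congr_fun hg x

/-- A linear map whose kernel is superfluous modulo `I` has superfluous kernel after reduction. -/
lemma Reduction.superfluous (hσ : ∀ s, π (σ s) = s) {L : Submodule R P}
    (hL : ∀ N : Submodule R P, N ⊔ L = ⊤ → N = ⊤) (L' : Submodule S (Reduction π σ P))
    (hL' : ∀ x, Reduction.mk π σ P x ∈ L' → x ∈ L ⊔ RingHom.ker π • (⊤ : Submodule R P))
    (N : Submodule S (Reduction π σ P)) (hN : N ⊔ L' = ⊤) : N = ⊤ := by
  -- The preimage of `N` contains `IP`, so it absorbs the error term allowed by `hL'`, and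
  -- superfluousness of `L` applies to it.
  let N' : Submodule R P :=
    { carrier := {x | Reduction.mk π σ P x ∈ N}
      add_mem' := fun hx hy => by simpa using N.add_mem hx hy
      zero_mem' := by simp
      smul_mem' := fun r x hx => by
        have := N.smul_mem (π r) hx
        rwa [Reduction.smul_mk hσ] at this }
  have hI : RingHom.ker π • (⊤ : Submodule R P) ≤ N' := fun x hx => by
    rw [← Reduction.ker_mk π σ, LinearMap.mem_ker] at hx
    change Reduction.mk π σ P x ∈ N
    rw [hx]
    exact N.zero_mem
  have hN' : N' = ⊤ := by
    refine hL N' (eq_top_iff.2 fun x _ => ?_)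
    have hx : Reduction.mk π σ P x ∈ N ⊔ L' := hN ▸ trivial
    obtain ⟨a, ha, b, hb, hab⟩ := Submodule.mem_sup.1 hx
    obtain ⟨a, rfl⟩ := Reduction.mk_surjective π σ a
    have hb' : Reduction.mk π σ P (x - a) ∈ L' := by
      rw [map_sub, ← hab, add_sub_cancel_left]
      exact hb
    have hle : L ⊔ RingHom.ker π • (⊤ : Submodule R P) ≤ N' ⊔ L :=
      sup_le le_sup_right (hI.trans le_sup_left)
    rw [← add_sub_cancel a x]
    exact add_mem (Submodule.mem_sup_left ha) (hle (hL' _ hb'))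
  refine eq_top_iff.2 fun x _ => ?_
  obtain ⟨x, rfl⟩ := Reduction.mk_surjective π σ x
  have hx : x ∈ N' := hN' ▸ trivial
  exact hx

/-- Let `P₁ → P₀ → M → 0` be a minimal projective presentation over `R` of an `S`-module `M`, with
`K = ker (P₀ → M)`. If `IK = IP₀`, then its reduction modulo `I` is a minimal projective
presentation of `M` over `S`. -/
lemma IsMinimalProjectivePresentation.reduction (hσ : ∀ s, π (σ s) = s) [Module S M]
    (hS : ∀ (s : S) (m : M), s • m = σ s • m)
    (hM : ∀ r ∈ RingHom.ker π, ∀ m : M, r • m = 0) {d₁ : P →ₗ[R] Q} {d₀ : Q →ₗ[R] M}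
    (h : IsMinimalProjectivePresentation d₁ d₀)
    (hK : RingHom.ker π • (⊤ : Submodule R Q) ≤ RingHom.ker π • LinearMap.ker d₀) :
    IsMinimalProjectivePresentation (Reduction.map π σ d₁) (Reduction.lift hS hM d₀) := by
  have := h.cover₀.finite
  have := h.cover₀.projective
  have := h.cover₁.finite
  have := h.cover₁.projective
  have hd (x) : d₀ (d₁ x) = 0 := by
    rw [← LinearMap.mem_ker, ← h.exact]
    exact ⟨x, rfl⟩
  refine ⟨⟨Reduction.finite hσ, Reduction.projective hσ, ?_, ?_⟩, ?_,
    ⟨Reduction.finite hσ, Reduction.projective hσ, LinearMap.surjective_rangeRestrict _, ?_⟩⟩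
  · intro m
    obtain ⟨x, rfl⟩ := h.cover₀.surjective m
    exact ⟨Reduction.mk π σ Q x, rfl⟩
  · exact Reduction.superfluous hσ h.cover₀.superfluous _ fun x hx => Submodule.mem_sup_left hx
  · refine le_antisymm ?_ fun x hx => ?_
    · rintro _ ⟨x, rfl⟩
      obtain ⟨x, rfl⟩ := Reduction.mk_surjective π σ x
      exact hd x
    · obtain ⟨x, rfl⟩ := Reduction.mk_surjective π σ x
      have hx' : x ∈ LinearMap.range d₁ := h.exact ▸ hx
      obtain ⟨y, rfl⟩ := hx'
      exact ⟨Reduction.mk π σ P y, rfl⟩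
  · refine Reduction.superfluous hσ h.cover₁.superfluous _ fun x hx => ?_
    rw [LinearMap.ker_rangeRestrict, LinearMap.mem_ker, Reduction.map_mk, ← LinearMap.mem_ker,
      Reduction.ker_mk] at hx
    rw [LinearMap.ker_rangeRestrict]
    -- Minimality at `P` uses `hK`: if `d₁ x` lies in `IQ = IK = d₁(IP)`, then `x` differs from an
    -- element of `IP` by an element of `ker d₁`.
    have himage : RingHom.ker π • LinearMap.ker d₀ ≤
        (RingHom.ker π • (⊤ : Submodule R P)).map d₁ := by
      refine Submodule.smul_le.2 fun r hr y hy => ?_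
      rw [← h.exact] at hy
      obtain ⟨z, rfl⟩ := hy
      exact ⟨r • z, Submodule.smul_mem_smul hr trivial, map_smul _ _ _⟩
    obtain ⟨z, hz, hzx⟩ := himage (hK hx)
    rw [← sub_add_cancel x z]
    refine add_mem (Submodule.mem_sup_left ?_) (Submodule.mem_sup_right hz)
    rw [LinearMap.mem_ker, map_sub, hzx, sub_self]

end Reduction

/-! ### Relation extensions -/

section RelationExtension

variable (k : Type u) [Field k] {C : Type u} [Ring C] [Algebra k C]

/-- The projection `B → C` on opposite rings. -/
abbrev opFst (C : Type u) [Ring C] [Algebra k C] : (RelationExtension k C)ᵐᵒᵖ →+* Cᵐᵒᵖ :=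
  (TrivSqZeroExt.fstHom k C (ExtBimodule k C)).toRingHom.op

/-- The inclusion `C → B` on opposite rings. -/
abbrev opInl (C : Type u) [Ring C] [Algebra k C] : Cᵐᵒᵖ →+* (RelationExtension k C)ᵐᵒᵖ :=
  (TrivSqZeroExt.inlHom C (ExtBimodule k C)).op

lemma opFst_opInl (c : Cᵐᵒᵖ) : opFst k C (opInl k C c) = c := rfl

lemma eq_op_inr_of_mem_ker {r : (RelationExtension k C)ᵐᵒᵖ} (hr : r ∈ RingHom.ker (opFst k C)) :
    r = op (TrivSqZeroExt.inr r.unop.snd) := by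
  have h : r.unop.fst = 0 := congrArg unop hr
  apply unop_injective
  ext
  · simpa using h
  · simp

/-- If `M ⊗ E = 0` and `K` is the kernel of a surjective `B`-linear map `P → M`, then `KE = PE`. -/
lemma ker_smul_top_le_ker_smul_ker (M : ModuleCat.{u} Cᵐᵒᵖ)
    (hM : ∀ (A : Type u) [AddCommGroup A] (β : M →+ ExtBimodule k C →+ A),
      (∀ (m : M) (c : C) (e : ExtBimodule k C), β (op c • m) e = β m (c • e)) → β = 0)
    {P : Type u} [AddCommGroup P] [Module (RelationExtension k C)ᵐᵒᵖ P]
    (d : P →ₗ[(RelationExtension k C)ᵐᵒᵖ] inflation k C M) (hd : Function.Surjective d) :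
    RingHom.ker (opFst k C) • (⊤ : Submodule (RelationExtension k C)ᵐᵒᵖ P) ≤
      RingHom.ker (opFst k C) • LinearMap.ker d := by
  let A := P ⧸ (RingHom.ker (opFst k C) • LinearMap.ker d)
  let q : P →ₗ[(RelationExtension k C)ᵐᵒᵖ] A := Submodule.mkQ _
  -- The pairing `(x, e) ↦ xe` modulo `KE` vanishes for `x` in `K`, so it descends to `M × E`. It is
  -- balanced because `(xc)e = x(ce)`, hence zero, which says that `PE ⊆ KE`.
  let γ : P →+ ExtBimodule k C →+ A :=
    AddMonoidHom.mk' (fun x => AddMonoidHom.mk'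
      (fun e => q (op (TrivSqZeroExt.inr e : RelationExtension k C) • x))
      (fun e e' => by rw [TrivSqZeroExt.inr_add, MulOpposite.op_add, add_smul, map_add]))
      (fun x y => by ext e; simp)
  have hinr (e : ExtBimodule k C) :
      op (TrivSqZeroExt.inr e : RelationExtension k C) ∈ RingHom.ker (opFst k C) := rfl
  let d' : P →+ M := d.toAddMonoidHom
  have hγ : d'.ker ≤ γ.ker := fun x hx => by
    rw [AddMonoidHom.mem_ker]
    ext e
    exact (Submodule.Quotient.mk_eq_zero _).2
      (Submodule.smul_mem_smul (hinr e) (LinearMap.mem_ker.2 hx))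
  let β : M →+ ExtBimodule k C →+ A := d'.liftOfSurjective hd ⟨γ, hγ⟩
  have hβd (x : P) : β (d x) = γ x := AddMonoidHom.liftOfRightInverse_comp_apply d' _ _ ⟨γ, hγ⟩ x
  have hβ : β = 0 := by
    refine hM A β fun m c e => ?_
    obtain ⟨x, rfl⟩ := hd m
    have hx : op c • (d x : M) = d (op (TrivSqZeroExt.inl c : RelationExtension k C) • x) :=
      (map_smul d (op (TrivSqZeroExt.inl c : RelationExtension k C)) x).symm
    refine (congrArg (fun m : M => β m e) hx).trans ?_
    rw [hβd, hβd]
    change q _ = q _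
    rw [← mul_smul, ← op_mul, TrivSqZeroExt.inl_mul_inr]
  refine Submodule.smul_le.2 fun r hr x _ => ?_
  rw [eq_op_inr_of_mem_ker k hr]
  refine (Submodule.Quotient.mk_eq_zero _).1 ?_
  change γ x _ = 0
  rw [← hβd, hβ]
  rfl

/-- The standard dual of a finite dimensional algebra is a finitely generated right module. -/
lemma finite_stdDual (C : Type u) [Ring C] [Algebra k C] [FiniteDimensional k C] :
    Module.Finite Cᵐᵒᵖ (StdDual k C C) := by
  obtain ⟨n, s, hs⟩ := Module.Finite.exists_fin (R := k) (M := Module.Dual k C)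
  rw [Module.finite_def, Submodule.fg_iff_exists_fin_generating_family]
  refine ⟨n, s, eq_top_iff.2 fun (x : Module.Dual k C) _ => ?_⟩
  have hx : x ∈ Submodule.span k (Set.range s) := hs ▸ trivial
  obtain ⟨c, rfl⟩ := (Submodule.mem_span_range_iff_exists_fun k).1 hx
  refine Submodule.sum_mem (M := StdDual k C C) _ fun i _ => ?_
  let s' : Fin n → StdDual k C C := s
  -- Scalars of `k` act on `DC` through `C`, so a spanning set over `k` also generates over `C`.
  have h : op (algebraMap k C (c i)) • s' i = (show StdDual k C C from c i • s i) := by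
    refine LinearMap.ext fun y => ?_
    change s i (algebraMap k C (c i) • y) = c i • s i y
    rw [algebraMap_smul, map_smul]
  have hs' : op (algebraMap k C (c i)) • s' i ∈ Submodule.span Cᵐᵒᵖ (Set.range s') :=
    Submodule.smul_mem _ _ (Submodule.subset_span ⟨i, rfl⟩)
  rw [h] at hs'
  exact hs'

end RelationExtension

end RelExt

end

/-! ### Passage from `C` to the relation extension -/

theorem proposition3p2 {k : Type u} [Field k] [IsAlgClosed k]
    {C : Type u} [Ring C] [Algebra k C] [FiniteDimensional k C]
    (hC : RelExt.GlobalDimensionLE C 2)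
    (M : ModuleCat.{u} Cᵐᵒᵖ) [Module.Finite Cᵐᵒᵖ M]
    (hM : RelExt.IsTauRigid k C M) (hid : HasInjectiveDimensionLE M 1) :
    RelExt.IsTauRigid k (RelExt.RelationExtension k C) (RelExt.inflation k C M) := by
  have : IsNoetherianRing Cᵐᵒᵖ := isNoetherian_of_tower k inferInstance
  have : Module.Finite Cᵐᵒᵖ (RelExt.dualModule k C) := RelExt.finite_stdDual k C
  have := hC (RelExt.dualModule k C) this
  intro P₁ P₀ _ _ _ _ d₁ d₀ hd f
  have := hd.cover₀.finite
  have := hd.cover₀.projective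
  have := hd.cover₁.finite
  have := hd.cover₁.projective
  have hker := RelExt.ker_smul_top_le_ker_smul_ker k M
    (fun A _ β hβ => RelExt.balanced_eq_zero k M β hβ) d₀ hd.cover₀.surjective
  -- The inflation has the same underlying group as `M`; keeping both actions on it lets the reduced
  -- presentation end in `M` over `C`.
  let : Module Cᵐᵒᵖ (RelExt.inflation k C M) := inferInstanceAs (Module Cᵐᵒᵖ M)
  let : Module k M := ModuleCat.moduleOfAlgebraModule M
  have : IsScalarTower k Cᵐᵒᵖ M := ModuleCat.isScalarTower_of_algebra_moduleCat M
  have hE : ∀ r ∈ RingHom.ker (RelExt.opFst k C), ∀ m : RelExt.inflation k C M, r • m = 0 := by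
    intro r hr m
    change RelExt.opFst k C r • (show M from m) = 0
    rw [RingHom.mem_ker.1 hr, zero_smul]
  have hmin := hd.reduction (π := RelExt.opFst k C) (σ := RelExt.opInl k C)
    (RelExt.opFst_opInl k) (fun _ _ => rfl) hE hker
  have := hmin.cover₁.finite
  have := hmin.cover₁.projective
  refine RelExt.eq_zero_of_forall_factors k d₁ (fun g => ?_) f
  -- The `C`-map induced by `g` on `P₁ / P₁E` factors through the reduced presentation. Composing
  -- `h` with `P₀ → P₀ / P₀E` gives the required `B`-map, because `B` acts on both the quotient and
  -- `M` through `C`.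
  obtain ⟨h, hh⟩ := RelExt.exists_factor_of_forall_eq_zero (M := M) k _ (hM _ _ _ _ hmin)
    (RelExt.Reduction.lift (M := RelExt.inflation k C M) (fun _ _ => rfl) hE g)
  refine ⟨⟨⟨fun x => h (RelExt.Reduction.mk _ _ _ x), fun x y =>
    (congrArg h (map_add _ x y)).trans (map_add h _ _)⟩, fun r x => ?_⟩, ?_⟩
  · change h (RelExt.Reduction.mk _ _ _ (r • x)) = RelExt.opFst k C r • h _
    rw [← RelExt.Reduction.smul_mk (RelExt.opFst_opInl k), map_smul]
  · ext x
    exact LinearMap.congr_fun hh (RelExt.Reduction.mk _ _ _ x)
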